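/- Let $\gamma\in(0,1)$. (1) For all $\delta\in(0,1)$ and $\lambda>0$, put $d=2\left\lceil \log(4/\delta)/(1-\gamma)\right\rceil$ ($\log$ the natural logarithm). Then there exist complex numbers $z_j$, $-d\le j\le d$, with $\sum_{j=-d}^{d}|z_j|\le 1$ and $$\max_{x\in[-\gamma,\gamma]}\left|\sum_{j=-d}^{d}z_j e^{ij\pi x/2}-e^{-\lambda(x+1)}\right|\le\delta .$$ Now let $H\neq 0$ be a bounded self-adjoint operator on a complex Hilbert space (for example, a nonzero Hermitian matrix), let $\|\cdot\|$ be the operator norm, let $\beta>0$, and put $$dt=\frac{\pi\gamma}{2\|H\|},\qquad U=e^{iH\,dt},\qquad \lambda=\frac{\beta\|H\|}{\gamma}.$$ For an integer $d\ge 0$ and complex numbers $z_j$, $-d\le j\le d$, consider the Laurent polynomial $$p_{d}(U)=\sum_{j=-d}^{d}e^{\beta\|H\|/\gamma}z_j\,U^j .$$ (2) If $\left|\sum_{j=-d}^{d}z_j e^{ij\pi x/2}-e^{-\lambda(x+1)}\right|\le\delta$ for all $x\in[-\gamma,\gamma]$, for some real $\delta$, then $$\left\|p_{d}(U)-e^{-\beta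 H}\right\|\le\delta\, e^{\beta\|H\|/\gamma}.$$ (3) For every integer $d\ge 0$ the $z_j$ can be chosen so that $\sum_{j=-d}^{d}|z_j|\le 1$, so that $$\left|\sum_{j=-d}^{d}z_j e^{ij\pi x/2}-e^{-\lambda(x+1)}\right|\le 4e^{-d(1-\gamma)/2}\quad\text{for all }x\in[-\gamma,\gamma],$$ and so that $$\left\|p_{d}(U)-e^{-\beta H}\right\|\le 4\exp\left(\frac{\beta\|H\|}{\gamma}-\frac d2(1-\gamma)\right).$$ -/

import Mathlib

/-- The value at the real point `x` of the trigonometric polynomial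
`∑_{j=-d}^{d} z_j e^{i j π x / 2}`. -/
noncomputable def trigPoly (d : ℕ) (z : ℤ → ℂ) (x : ℝ) : ℂ :=
  ∑ j ∈ Finset.Icc (-(d : ℤ)) (d : ℤ),
    z j * Complex.exp (Complex.I * (j : ℂ) * (Real.pi : ℂ) * (x : ℂ) / 2)

/-- The sum `∑_{j=-d}^{d} |z_j|`. -/
noncomputable def coeffNorm (d : ℕ) (z : ℤ → ℂ) : ℝ :=
  ∑ j ∈ Finset.Icc (-(d : ℤ)) (d : ℤ), ‖z j‖

/-- The degree `2 ⌈log (4 / δ) / (1 - γ)⌉`. -/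
noncomputable def gibbsDegree (γ δ : ℝ) : ℕ :=
  2 * ⌈Real.log (4 / δ) / (1 - γ)⌉₊

section Operators

variable {E : Type*} [NormedAddCommGroup E] [InnerProductSpace ℂ E] [CompleteSpace E]

/-- The time step `dt = π γ / (2 ‖H‖)`. -/
noncomputable def gibbsTimeStep (γ : ℝ) (H : selfAdjoint (E →L[ℂ] E)) : ℝ :=
  Real.pi * γ / (2 * ‖(H : E →L[ℂ] E)‖)

/-- The unitary time evolution `U = e^{i H t}`. -/
noncomputable def timeEvolution (H : selfAdjoint (E →L[ℂ] E)) (t : ℝ) :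
    unitary (E →L[ℂ] E) :=
  selfAdjoint.expUnitary (t • H)

/-- The Laurent polynomial `∑_{j=-d}^{d} c_j U^j` in a unitary operator `U`. -/
noncomputable def laurentInUnitary (d : ℕ) (c : ℤ → ℂ) (U : unitary (E →L[ℂ] E)) :
    E →L[ℂ] E :=
  ∑ j ∈ Finset.Icc (-(d : ℤ)) (d : ℤ), c j • ((U ^ j : unitary (E →L[ℂ] E)) : E →L[ℂ] E)

/-- The Laurent polynomial in `U = e^{i H dt}`, `dt = π γ / (2 ‖H‖)`, whose coefficients are the
rescaled numbers `e^{β ‖H‖ / γ} z_j`. -/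
noncomputable def gibbsLaurent (β γ : ℝ) (H : selfAdjoint (E →L[ℂ] E)) (d : ℕ) (z : ℤ → ℂ) :
    E →L[ℂ] E :=
  laurentInUnitary d (fun j => (Real.exp (β * ‖(H : E →L[ℂ] E)‖ / γ) : ℂ) * z j)
    (timeEvolution H (gibbsTimeStep γ H))

/-- The unnormalized Gibbs operator `e^{-β H}`. -/
noncomputable def gibbsOperator (β : ℝ) (H : selfAdjoint (E →L[ℂ] E)) : E →L[ℂ] E :=
  NormedSpace.exp (((-β : ℝ) : ℂ) • (H : E →L[ℂ] E))

end Operators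

/-! With y = sin(πx/2), on [-γ, γ] one has x = (2/π) arcsin y, so e^{-λ(x+1)} is the power series
e^{-λ} ∑ (-λ)^k/k! ((2/π) arcsin y)^k in y. Since arcsin has nonnegative Taylor coefficients and
(2/π) arcsin 1 = 1, its coefficients have absolute sum at most e^{-λ} e^λ = 1, whatever λ is;
`exists_polynomial_approx_exp` does this with truncated series.

It then suffices to approximate every y^l in degree d with coefficient norm at most 1 and an error
independent of l (`exists_trigPoly_approx_sin_pow`). The frequencies of sin^l carry binomial
weights: for small l those beyond d have small mass by Chernoff, and for large l the power itself is
tiny because |y| stays away from 1. Hence the degree does not depend on λ.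

The operator bounds follow by continuous functional calculus, after rescaling the spectrum of H into
[-γ, γ]. -/

/-! ### Polynomial approximation in the variable sin(πx/2) -/

/-- The power series of `1 / √(1 - y²)` has nonnegative coefficients and converges uniformly on
compact subintervals of `(-1, 1)`. -/
theorem exists_coeff_one_sub_rpow_neg_half : ∃ b : ℕ → ℝ, (∀ n, 0 ≤ b n) ∧
    (∀ y : ℝ, |y| < 1 → HasSum (fun n => b n * y ^ (2 * n)) (1 / √(1 - y ^ 2))) ∧
    ∀ r : ℝ, 0 ≤ r → r < 1 → ∀ ε > 0, ∃ N : ℕ, ∀ y : ℝ, |y| ≤ r →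
      |1 / √(1 - y ^ 2) - ∑ n ∈ Finset.range N, b n * y ^ (2 * n)| ≤ ε := by
  have hps := Real.one_div_one_sub_rpow_hasFPowerSeriesOnBall_zero (1 / 2)
  have hnonneg : ∀ n : ℕ, 0 ≤ Ring.choose ((1 / 2 : ℝ) + n - 1) n := fun n => by
    have h := Ring.factorial_nsmul_multichoose_eq_ascPochhammer (1 / 2 : ℝ) n
    rw [Polynomial.ascPochhammer_smeval_eq_eval, Ring.multichoose_eq] at h
    have h2 := ascPochhammer_pos n (1 / 2 : ℝ) (by norm_num)
    rw [← h, nsmul_eq_mul] at h2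
    exact (pos_of_mul_pos_right h2 (by positivity)).le
  have hsum : ∀ y : ℝ, |y| < 1 →
      HasSum (fun n : ℕ => Ring.choose ((1 / 2 : ℝ) + n - 1) n * y ^ (2 * n))
        (1 / √(1 - y ^ 2)) := fun y hy => by
    have hmem : y ^ 2 ∈ Metric.eball (0 : ℝ) 1 := by
      rw [← ENNReal.ofReal_one, Metric.eball_ofReal, mem_ball_zero_iff, norm_pow, Real.norm_eq_abs]
      exact pow_lt_one₀ (abs_nonneg y) hy two_ne_zero
    have h := hps.hasSum hmem
    simp only [zero_add, FormalMultilinearSeries.ofScalars_apply_eq, smul_eq_mul, ← pow_mul,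
      ← Real.sqrt_eq_rpow] at h
    exact h
  refine ⟨fun n => Ring.choose ((1 / 2 : ℝ) + n - 1) n, hnonneg, hsum, fun r hr0 hr1 ε hε => ?_⟩
  have hS := hsum r (by rwa [abs_of_nonneg hr0])
  obtain ⟨N, hN⟩ := (Metric.tendsto_atTop.1 hS.tendsto_sum_nat ε hε)
  refine ⟨N, fun y hy => ?_⟩
  have hyS := hsum y (hy.trans_lt hr1)
  have h1 := (hasSum_nat_add_iff' N).2 hyS
  have h2 := (hasSum_nat_add_iff' N).2 hS
  have h3 := hN N le_rfl
  rw [Real.dist_eq, abs_sub_comm] at h3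
  have hpow : ∀ k : ℕ, 0 ≤ y ^ (2 * k) := fun k => (even_two_mul k).pow_nonneg y
  -- All terms are nonnegative and even in y, so the tail at y is at most the tail at r; this gives
  -- uniformity.
  rw [abs_of_nonneg (h1.nonneg fun k => mul_nonneg (hnonneg _) (hpow _))]
  refine (hasSum_le (fun k => ?_) h1 h2).trans ((le_abs_self _).trans h3.le)
  refine mul_le_mul_of_nonneg_left ?_ (hnonneg _)
  rw [← (even_two_mul _).pow_abs y]
  exact pow_le_pow_left₀ (abs_nonneg y) hy _

/-- Polynomials with nonnegative coefficients of sum at most one which approximate the normalized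
arcsine. -/
theorem exists_polynomial_approx_arcsin {r : ℝ} (hr0 : 0 ≤ r) (hr1 : r < 1) {ε : ℝ} (hε : 0 < ε) :
    ∃ q : Polynomial ℝ, (∀ n, 0 ≤ q.coeff n) ∧ q.eval 1 ≤ 1 ∧
      ∀ y : ℝ, |y| ≤ r → |q.eval y - 2 / Real.pi * Real.arcsin y| ≤ ε := by
  obtain ⟨b, hb0, hbsum, hbunif⟩ := exists_coeff_one_sub_rpow_neg_half
  obtain ⟨N, hN⟩ := hbunif r hr0 hr1 ε hε
  set S : ℝ → ℝ := fun y => ∑ n ∈ Finset.range N, b n / (2 * n + 1) * y ^ (2 * n + 1) with hS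
  have hSderiv : ∀ y, HasDerivAt S (∑ n ∈ Finset.range N, b n * y ^ (2 * n)) y := fun y => by
    refine HasDerivAt.fun_sum fun n _ => ?_
    have h := (hasDerivAt_pow (2 * n + 1) y).const_mul (b n / (2 * n + 1))
    refine h.congr_deriv ?_
    push_cast
    have : (2 * n + 1 : ℝ) ≠ 0 := by positivity
    field_simp
  have hder : ∀ y : ℝ, |y| < 1 → HasDerivAt (fun y => Real.arcsin y - S y)
      (1 / √(1 - y ^ 2) - ∑ n ∈ Finset.range N, b n * y ^ (2 * n)) y := fun y hy => by
    have := abs_lt.1 hy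
    exact (Real.hasDerivAt_arcsin this.1.ne' this.2.ne).sub (hSderiv y)
  have hS0 : S 0 = 0 := by simp [hS]
  -- The derivative of arcsin - S is a tail of nonnegative terms. Monotonicity up to the endpoint
  -- bounds S 1 by arcsin 1 without any convergence statement at y = 1.
  have hmono : MonotoneOn (fun y => Real.arcsin y - S y) (Set.Icc 0 1) := by
    have hint : ∀ y ∈ interior (Set.Icc (0 : ℝ) 1), |y| < 1 := fun y hy => by
      rw [interior_Icc] at hy
      exact abs_lt.2 ⟨by linarith [hy.1], hy.2⟩
    refine monotoneOn_of_deriv_nonneg (convex_Icc 0 1) ?_ ?_ ?_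
    · exact (Real.continuous_arcsin.sub
        (continuous_iff_continuousAt.2 fun y => (hSderiv y).continuousAt)).continuousOn
    · exact fun y hy => (hder y (hint y hy)).differentiableAt.differentiableWithinAt
    · intro y hy
      rw [(hder y (hint y hy)).deriv, sub_nonneg]
      exact sum_le_hasSum _ (fun n _ => mul_nonneg (hb0 n) ((even_two_mul n).pow_nonneg y))
        (hbsum y (hint y hy))
  have hS1 : S 1 ≤ Real.pi / 2 := by
    have h := hmono (Set.left_mem_Icc.2 zero_le_one) (Set.right_mem_Icc.2 zero_le_one) zero_le_one
    simp only [Real.arcsin_zero, hS0, Real.arcsin_one] at h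
    linarith
  set q : Polynomial ℝ := ∑ n ∈ Finset.range N,
    Polynomial.monomial (2 * n + 1) (2 / Real.pi * (b n / (2 * n + 1))) with hq
  have hqS : ∀ y, q.eval y = 2 / Real.pi * S y := fun y => by
    simp [hq, hS, Polynomial.eval_finsetSum, Finset.mul_sum, mul_assoc]
  have hpi := Real.pi_pos
  refine ⟨q, fun n => ?_, ?_, fun y hy => ?_⟩
  · rw [hq, Polynomial.finsetSum_coeff]
    refine Finset.sum_nonneg fun k _ => ?_
    rw [Polynomial.coeff_monomial]
    have := hb0 k
    split_ifs <;> positivity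
  · rw [hqS]
    calc 2 / Real.pi * S 1 ≤ 2 / Real.pi * (Real.pi / 2) := by gcongr
      _ = 1 := by field_simp
  -- Mean value inequality from 0, where arcsin and S both vanish.
  · have h := (convex_Icc (-r) r).norm_image_sub_le_of_norm_hasDerivWithin_le (x := 0) (y := y)
      (fun z hz => (hder z ((abs_le.2 hz).trans_lt hr1)).hasDerivWithinAt)
      (fun z hz => hN z (abs_le.2 hz)) ⟨by linarith, hr0⟩ (abs_le.1 hy)
    simp only [Real.arcsin_zero, hS0, sub_zero, Real.norm_eq_abs] at h
    rw [hqS, ← mul_sub, abs_mul, abs_sub_comm, abs_of_pos (by positivity)]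
    have h2 : 2 / Real.pi ≤ 1 := by
      rw [div_le_one hpi]; exact Real.two_le_pi
    calc 2 / Real.pi * |Real.arcsin y - S y| ≤ 1 * (ε * |y|) := by gcongr
      _ ≤ 1 * (ε * 1) := by gcongr; linarith
      _ = ε := by ring

theorem abs_exp_sub_exp_le_of_nonpos {s t : ℝ} (hs : s ≤ 0) (ht : t ≤ 0) :
    |Real.exp s - Real.exp t| ≤ |s - t| := by
  have key : ∀ {a b : ℝ}, a ≤ 0 → Real.exp a - Real.exp b ≤ |a - b| := fun {a b} ha => by
    have h1 : Real.exp b = Real.exp a * Real.exp (b - a) := by rw [← Real.exp_add]; ring_nf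
    have h2 := Real.add_one_le_exp (b - a)
    have h3 := Real.exp_le_one_iff.2 ha
    have h4 := (Real.exp_pos a).le
    have h5 := le_abs_self (a - b)
    have h6 := abs_nonneg (a - b)
    nlinarith
  rw [abs_le]
  refine ⟨?_, key hs⟩
  have := key (b := s) ht
  rw [abs_sub_comm] at this
  linarith

/-- On `[-γ, γ]` the function `e^{-λ(x+1)}` is uniformly approximated by polynomials in
`sin (πx/2)` whose coefficients have absolute sum at most one. -/
theorem exists_polynomial_approx_exp {γ : ℝ} (hγ : γ ∈ Set.Ioo (0 : ℝ) 1) {lam : ℝ} (hlam : 0 < lam)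
    {ε : ℝ} (hε : 0 < ε) :
    ∃ p : Polynomial ℝ, ∑ n ∈ Finset.range (p.natDegree + 1), |p.coeff n| ≤ 1 ∧
      ∀ x ∈ Set.Icc (-γ) γ,
        |p.eval (Real.sin (Real.pi * x / 2)) - Real.exp (-lam * (x + 1))| ≤ ε := by
  have hpi := Real.pi_pos
  have hr0 : 0 ≤ Real.sin (Real.pi * γ / 2) :=
    Real.sin_nonneg_of_nonneg_of_le_pi (by have := hγ.1; positivity) (by nlinarith [hγ.2])
  have hr1 : Real.sin (Real.pi * γ / 2) < 1 := by
    rw [← Real.sin_pi_div_two]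
    exact Real.sin_lt_sin_of_lt_of_le_pi_div_two (by nlinarith [hγ.1]) le_rfl (by nlinarith [hγ.2])
  -- The map t ↦ e^{-λ(t+1)} is λ-Lipschitz on t ≥ -1, so this accuracy costs ε/2; truncating the
  -- exponential series costs the other half.
  obtain ⟨q, hq0, hq1, hq⟩ := exists_polynomial_approx_arcsin hr0 hr1
    (ε := ε / (2 * lam)) (by positivity)
  have hqabs : ∀ y : ℝ, |y| ≤ 1 → |q.eval y| ≤ 1 := fun y hy => by
    refine le_trans ?_ hq1
    rw [Polynomial.eval_eq_sum_range, Polynomial.eval_eq_sum_range]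
    refine (Finset.abs_sum_le_sum_abs _ _).trans (Finset.sum_le_sum fun n _ => ?_)
    rw [abs_mul, abs_of_nonneg (hq0 n), abs_pow, one_pow]
    exact mul_le_mul_of_nonneg_left (pow_le_one₀ (abs_nonneg y) hy) (hq0 n)
  have hqpow : ∀ k n, 0 ≤ (q ^ k).coeff n := fun k => by
    induction k with
    | zero => intro n; rw [pow_zero, Polynomial.coeff_one]; split_ifs <;> norm_num
    | succ k ih =>
      intro n
      rw [pow_succ, Polynomial.coeff_mul]
      exact Finset.sum_nonneg fun i _ => mul_nonneg (ih _) (hq0 _)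
  have hexp : HasSum (fun k : ℕ => lam ^ k / (k.factorial : ℝ)) (Real.exp lam) := by
    rw [Real.exp_eq_exp_ℝ]
    exact NormedSpace.expSeries_div_hasSum_exp lam
  obtain ⟨K, hK⟩ := Metric.tendsto_atTop.1 hexp.tendsto_sum_nat (ε / 2) (by positivity)
  have hKε := hK K le_rfl
  rw [Real.dist_eq, abs_sub_comm] at hKε
  have hKε' := (le_abs_self _).trans hKε.le
  set p : Polynomial ℝ := ∑ k ∈ Finset.range K,
    Polynomial.C (Real.exp (-lam) * ((-lam) ^ k / (k.factorial : ℝ))) * q ^ k with hp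
  have hcoeff : ∀ n, |p.coeff n| ≤ ∑ k ∈ Finset.range K,
      Real.exp (-lam) * (lam ^ k / (k.factorial : ℝ)) * (q ^ k).coeff n := fun n => by
    rw [hp, Polynomial.finsetSum_coeff]
    refine (Finset.abs_sum_le_sum_abs _ _).trans (le_of_eq (Finset.sum_congr rfl fun k _ => ?_))
    rw [Polynomial.coeff_C_mul, abs_mul, abs_of_nonneg (hqpow k n), abs_mul, Real.abs_exp, abs_div,
      abs_pow, abs_neg, abs_of_pos hlam, Nat.abs_cast]
  refine ⟨p, ?_, fun x hx => ?_⟩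
  · calc ∑ n ∈ Finset.range (p.natDegree + 1), |p.coeff n|
        ≤ ∑ n ∈ Finset.range (p.natDegree + 1), ∑ k ∈ Finset.range K,
          Real.exp (-lam) * (lam ^ k / (k.factorial : ℝ)) * (q ^ k).coeff n :=
          Finset.sum_le_sum fun n _ => hcoeff n
      _ = ∑ k ∈ Finset.range K, Real.exp (-lam) * (lam ^ k / (k.factorial : ℝ)) *
          ∑ n ∈ Finset.range (p.natDegree + 1), (q ^ k).coeff n := by
          rw [Finset.sum_comm]; simp_rw [Finset.mul_sum]
      _ ≤ ∑ k ∈ Finset.range K, Real.exp (-lam) * (lam ^ k / (k.factorial : ℝ)) * 1 := by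
          refine Finset.sum_le_sum fun k _ => mul_le_mul_of_nonneg_left ?_ (by positivity)
          have hle : (q ^ k).eval 1 ≤ 1 := by
            rw [Polynomial.eval_pow]
            exact pow_le_one₀ (by
              rw [Polynomial.eval_eq_sum_range]
              exact Finset.sum_nonneg fun n _ => mul_nonneg (hq0 n) (by simp)) hq1
          refine le_trans ?_ hle
          -- The maximum covers both degrees, since cancellation may make that of p smaller than
          -- that of q ^ k.
          rw [Polynomial.eval_eq_sum_range' (n := max (p.natDegree + 1) ((q ^ k).natDegree + 1))
            (lt_of_lt_of_le (Nat.lt_succ_self _) (le_max_right _ _))]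
          simp only [one_pow, mul_one]
          exact Finset.sum_le_sum_of_subset_of_nonneg
            (Finset.range_subset_range.2 (le_max_left _ _)) fun n _ _ => hqpow k n
      _ = Real.exp (-lam) * ∑ k ∈ Finset.range K, lam ^ k / (k.factorial : ℝ) := by
          simp_rw [mul_one, Finset.mul_sum]
      _ ≤ Real.exp (-lam) * Real.exp lam := by
          gcongr
          exact Real.sum_le_exp_of_nonneg hlam.le K
      _ = 1 := by rw [← Real.exp_add]; simp
  · set y := Real.sin (Real.pi * x / 2) with hy
    have hyr : |y| ≤ Real.sin (Real.pi * γ / 2) := by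
      rw [abs_le, ← Real.sin_neg]
      constructor <;> apply Real.sin_le_sin_of_le_of_le_pi_div_two <;>
        nlinarith [hx.1, hx.2, hγ.1, hγ.2]
    have harc : 2 / Real.pi * Real.arcsin y = x := by
      rw [hy, Real.arcsin_sin (by nlinarith [hx.1, hγ.2]) (by nlinarith [hx.2, hγ.2])]
      field_simp
    have hw := hq y hyr
    rw [harc] at hw
    have hw1 := hqabs y (Real.abs_sin_le_one _)
    set w := q.eval y with hwdef
    have h1 : |p.eval y - Real.exp (-lam * (w + 1))| ≤ ε / 2 := by
      have hpe : p.eval y = Real.exp (-lam) *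
          ∑ k ∈ Finset.range K, (-lam * w) ^ k / (k.factorial : ℝ) := by
        simp only [hp, Polynomial.eval_finsetSum, Polynomial.eval_mul, Polynomial.eval_C,
          Polynomial.eval_pow, Finset.mul_sum, mul_pow]
        exact Finset.sum_congr rfl fun k _ => by ring
      have hee : Real.exp (-lam * (w + 1)) = Real.exp (-lam) * Real.exp (-lam * w) := by
        rw [← Real.exp_add]; ring_nf
      have htail : |∑ k ∈ Finset.range K, (-lam * w) ^ k / (k.factorial : ℝ)
          - Real.exp (-lam * w)| ≤ ε / 2 := by
        refine le_trans ?_ hKε'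
        have hS2 : HasSum (fun k : ℕ => (-lam * w) ^ k / (k.factorial : ℝ))
            (Real.exp (-lam * w)) := by
          rw [Real.exp_eq_exp_ℝ]
          exact NormedSpace.expSeries_div_hasSum_exp _
        have h2 := (hasSum_nat_add_iff' K).2 hS2
        have h3 := (hasSum_nat_add_iff' K).2 hexp
        rw [abs_sub_comm, ← Real.norm_eq_abs]
        refine h2.norm_le_of_bounded h3 fun k => ?_
        rw [Real.norm_eq_abs, abs_div, abs_pow, abs_mul, abs_neg, abs_of_pos hlam, Nat.abs_cast]
        gcongr
        exact mul_le_of_le_one_right hlam.le hw1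
      rw [hpe, hee, ← mul_sub, abs_mul, Real.abs_exp]
      calc _ ≤ 1 * (ε / 2) := by
            gcongr
            exact Real.exp_le_one_iff.2 (by linarith)
        _ = ε / 2 := one_mul _
    have h2 : |Real.exp (-lam * (w + 1)) - Real.exp (-lam * (x + 1))| ≤ ε / 2 := by
      have hwl := (abs_le.1 hw1).1
      refine (abs_exp_sub_exp_le_of_nonpos (by nlinarith) (by nlinarith [hx.1, hγ.2])).trans ?_
      rw [show -lam * (w + 1) - -lam * (x + 1) = -lam * (w - x) by ring, abs_mul, abs_neg,
        abs_of_pos hlam]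
      calc lam * |w - x| ≤ lam * (ε / (2 * lam)) := by gcongr
        _ = ε / 2 := by field_simp
    calc _ ≤ _ := abs_sub_le _ (Real.exp (-lam * (w + 1))) _
      _ ≤ ε := by linarith

/-! ### Trigonometric truncation of powers of the sine -/

/-- By concavity, sin lies above its chord on [0, π/4]; the half-angle formula turns this into
cos(πu/2) ≤ 1 - u² ≤ e^{-u²}. -/
theorem cos_pi_mul_div_two_le_exp {u : ℝ} (hu0 : 0 ≤ u) (hu1 : u ≤ 1) :
    Real.cos (Real.pi * u / 2) ≤ Real.exp (-u ^ 2) := by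
  have hpi := Real.pi_pos
  have h := strictConcaveOn_sin_Icc.concaveOn.2 (x := 0) (y := Real.pi / 4)
    ⟨le_rfl, hpi.le⟩ ⟨by positivity, by linarith⟩ (sub_nonneg.2 hu1) hu0 (by ring)
  simp only [smul_eq_mul, Real.sin_zero, mul_zero, zero_add, Real.sin_pi_div_four] at h
  have hcos : Real.cos (Real.pi * u / 2) = 1 - 2 * Real.sin (u * (Real.pi / 4)) ^ 2 := by
    rw [show Real.pi * u / 2 = 2 * (u * (Real.pi / 4)) by ring, Real.cos_two_mul, Real.cos_sq']
    ring
  have hsq : (u * (√2 / 2)) ^ 2 ≤ Real.sin (u * (Real.pi / 4)) ^ 2 :=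
    pow_le_pow_left₀ (by positivity) h 2
  rw [mul_pow, div_pow, Real.sq_sqrt zero_le_two] at hsq
  have := Real.add_one_le_exp (-u ^ 2)
  rw [hcos]
  linarith

/-- Grouping the frequencies in a finite exponential sum and dropping those above `d`. -/
theorem exists_coeff_trigPoly_truncation {ι : Type*} (s : Finset ι) (w : ι → ℂ) (k : ι → ℤ)
    (d : ℕ) : ∃ z : ℤ → ℂ, coeffNorm d z ≤ ∑ m ∈ s, ‖w m‖ ∧
      ∀ x : ℝ, trigPoly d z x = ∑ m ∈ s with k m ∈ Finset.Icc (-(d : ℤ)) d,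
        w m * Complex.exp (Complex.I * (k m : ℂ) * (Real.pi : ℂ) * (x : ℂ) / 2) := by
  refine ⟨fun j => ∑ m ∈ s with k m = j, w m, ?_, fun x => ?_⟩
  · calc coeffNorm d _ ≤ ∑ j ∈ Finset.Icc (-(d : ℤ)) d, ∑ m ∈ s with k m = j, ‖w m‖ :=
          Finset.sum_le_sum fun j _ => norm_sum_le _ _
      _ ≤ ∑ m ∈ s, ‖w m‖ :=
          Finset.sum_fiberwise_le_sum_of_sum_fiber_nonneg fun _ _ =>
            Finset.sum_nonneg fun _ _ => norm_nonneg _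
  · unfold trigPoly
    rw [← Finset.sum_fiberwise_of_maps_to (t := Finset.Icc (-(d : ℤ)) d) (g := k)
      fun m hm => (Finset.mem_filter.1 hm).2]
    refine Finset.sum_congr rfl fun j hj => ?_
    rw [Finset.sum_mul, Finset.filter_filter]
    refine Finset.sum_congr (Finset.filter_congr fun m _ => ?_) fun m hm => ?_
    · exact ⟨fun h => ⟨h ▸ hj, h⟩, fun h => h.2⟩
    · rw [(Finset.mem_filter.1 hm).2.2]

theorem sin_pow_eq_sum (l : ℕ) (x : ℝ) :
    ((Real.sin (Real.pi * x / 2) : ℝ) : ℂ) ^ l = ∑ m ∈ Finset.range (l + 1),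
      ((-Complex.I / 2) ^ m * (Complex.I / 2) ^ (l - m) * (l.choose m : ℂ)) *
        Complex.exp (Complex.I * ((2 * (m : ℤ) - l : ℤ) : ℂ) * (Real.pi : ℂ) * (x : ℂ) / 2) := by
  set θ : ℂ := (Real.pi : ℂ) * x / 2 with hθ
  have hsin : ((Real.sin (Real.pi * x / 2) : ℝ) : ℂ) =
      -Complex.I / 2 * Complex.exp (θ * Complex.I) + Complex.I / 2 * Complex.exp (-θ * Complex.I) := by
    rw [Complex.ofReal_sin, Complex.sin]
    push_cast
    rw [← hθ]
    ring
  rw [hsin, add_pow]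
  refine Finset.sum_congr rfl fun m hm => ?_
  have hml : m ≤ l := Nat.lt_succ_iff.1 (Finset.mem_range.1 hm)
  have hexp : Complex.exp (Complex.I * ((2 * (m : ℤ) - l : ℤ) : ℂ) * (Real.pi : ℂ) * (x : ℂ) / 2) =
      Complex.exp (θ * Complex.I) ^ m * Complex.exp (-θ * Complex.I) ^ (l - m) := by
    rw [← Complex.exp_nat_mul, ← Complex.exp_nat_mul, ← Complex.exp_add, hθ]
    congr 1
    push_cast [Nat.cast_sub hml]
    ring
  rw [hexp, mul_pow, mul_pow]
  ring

theorem norm_sin_pow_coeff {l m : ℕ} (hml : m ≤ l) :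
    ‖(-Complex.I / 2) ^ m * (Complex.I / 2) ^ (l - m) * (l.choose m : ℂ)‖ =
      (1 / 2) ^ l * (l.choose m : ℝ) := by
  simp only [norm_mul, norm_pow, norm_div, norm_neg, Complex.norm_I, Complex.norm_natCast,
    Complex.norm_ofNat]
  rw [← pow_add, Nat.add_sub_cancel' hml]

/-- The moment generating function of a sum of l independent random signs; s = 0 gives total mass
one. -/
theorem sum_choose_mul_exp (l : ℕ) (s : ℝ) :
    ∑ m ∈ Finset.range (l + 1), (1 / 2 : ℝ) ^ l * (l.choose m : ℝ) *
      Real.exp (s * (2 * (m : ℝ) - l)) = Real.cosh s ^ l := by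
  rw [Real.cosh_eq, add_div, add_pow]
  refine Finset.sum_congr rfl fun m hm => ?_
  have hml : m ≤ l := Nat.lt_succ_iff.1 (Finset.mem_range.1 hm)
  have hexp : Real.exp (s * (2 * (m : ℝ) - l)) = Real.exp s ^ m * Real.exp (-s) ^ (l - m) := by
    rw [← Real.exp_nat_mul, ← Real.exp_nat_mul, ← Real.exp_add, Nat.cast_sub hml]
    ring_nf
  have hpow : (2 : ℝ) ^ l = 2 ^ m * 2 ^ (l - m) := by rw [← pow_add, Nat.add_sub_cancel' hml]
  rw [hexp, div_pow, div_pow, div_pow, hpow, one_pow]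
  field_simp

/-- Chernoff bound for the symmetric binomial distribution. -/
theorem sum_choose_tail_le (l d : ℕ) {s : ℝ} (hs : 0 ≤ s) :
    ∑ m ∈ (Finset.range (l + 1)).filter (fun m : ℕ => ¬ (2 * (m : ℤ) - l) ∈ Finset.Icc (-(d : ℤ)) d),
      (1 / 2 : ℝ) ^ l * (l.choose m : ℝ) ≤ 2 * Real.exp (l * s ^ 2 / 2 - s * d) := by
  have hcosh : Real.cosh s ^ l ≤ Real.exp (l * s ^ 2 / 2) := by
    rw [mul_div_assoc, Real.exp_nat_mul]
    exact pow_le_pow_left₀ (Real.cosh_pos s).le (Real.cosh_le_exp_half_sq s) l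
  calc _ ≤ ∑ m ∈ (Finset.range (l + 1)).filter (fun m : ℕ => ¬ (2 * (m : ℤ) - l) ∈ Finset.Icc (-(d : ℤ)) d),
        Real.exp (-(s * d)) * ((1 / 2 : ℝ) ^ l * (l.choose m : ℝ) * Real.exp (s * (2 * (m : ℝ) - l)) +
          (1 / 2 : ℝ) ^ l * (l.choose m : ℝ) * Real.exp (-s * (2 * (m : ℝ) - l))) := by
        -- When |2m - l| > d, one of the two exponentials alone already outweighs e^{sd}.
        refine Finset.sum_le_sum fun m hm => ?_
        have hm2 := (Finset.mem_filter.1 hm).2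
        rw [Finset.mem_Icc, not_and_or, not_le, not_le] at hm2
        rw [← mul_add, mul_left_comm]
        refine le_mul_of_one_le_right (by positivity) ?_
        rw [mul_add, ← Real.exp_add, ← Real.exp_add]
        rcases hm2 with hm2 | hm2
        · have h : (2 * (m : ℝ) - l) < -d := by exact_mod_cast hm2
          have := Real.one_le_exp (x := -(s * d) + -s * (2 * (m : ℝ) - l)) (by nlinarith)
          linarith [Real.exp_pos (-(s * d) + s * (2 * (m : ℝ) - l))]
        · have h : (d : ℝ) < (2 * (m : ℝ) - l) := by exact_mod_cast hm2
          have := Real.one_le_exp (x := -(s * d) + s * (2 * (m : ℝ) - l)) (by nlinarith)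
          linarith [Real.exp_pos (-(s * d) + -s * (2 * (m : ℝ) - l))]
    _ ≤ ∑ m ∈ Finset.range (l + 1),
        Real.exp (-(s * d)) * ((1 / 2 : ℝ) ^ l * (l.choose m : ℝ) * Real.exp (s * (2 * (m : ℝ) - l)) +
          (1 / 2 : ℝ) ^ l * (l.choose m : ℝ) * Real.exp (-s * (2 * (m : ℝ) - l))) :=
        Finset.sum_le_sum_of_subset_of_nonneg (Finset.filter_subset _ _)
          fun m _ _ => by positivity
    _ = Real.exp (-(s * d)) * (2 * Real.cosh s ^ l) := by
        rw [← Finset.mul_sum, Finset.sum_add_distrib, sum_choose_mul_exp, sum_choose_mul_exp,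
          Real.cosh_neg, two_mul]
    _ ≤ Real.exp (-(s * d)) * (2 * Real.exp (l * s ^ 2 / 2)) := by gcongr
    _ = _ := by rw [mul_left_comm, ← Real.exp_add]; ring_nf

/-- Put u = 1 - γ. If 2lu ≤ d, Chernoff with s = 2u bounds the discarded mass by 2e^{2lu² - 2ud} ≤
2e^{-ud}. Otherwise |sin(πx/2)|^l ≤ e^{-lu²} ≤ e^{-ud/2}, and the zero polynomial suffices. -/
theorem exists_trigPoly_approx_sin_pow {γ : ℝ} (hγ : γ ∈ Set.Ioo (0 : ℝ) 1) (d l : ℕ) :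
    ∃ z : ℤ → ℂ, coeffNorm d z ≤ 1 ∧ ∀ x ∈ Set.Icc (-γ) γ,
      ‖trigPoly d z x - ((Real.sin (Real.pi * x / 2) : ℝ) : ℂ) ^ l‖ ≤
        2 * Real.exp (-((d : ℝ) / 2 * (1 - γ))) := by
  have hu : 0 < 1 - γ := sub_pos.2 hγ.2
  have hpi := Real.pi_pos
  by_cases hl : (l : ℝ) * (2 * (1 - γ)) ≤ d
  · obtain ⟨z, hz1, hz2⟩ := exists_coeff_trigPoly_truncation (Finset.range (l + 1))
      (fun m => (-Complex.I / 2) ^ m * (Complex.I / 2) ^ (l - m) * (l.choose m : ℂ))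
      (fun m => 2 * (m : ℤ) - l) d
    have hnorm : ∀ m ∈ Finset.range (l + 1),
        ‖(-Complex.I / 2) ^ m * (Complex.I / 2) ^ (l - m) * (l.choose m : ℂ)‖ =
          (1 / 2) ^ l * (l.choose m : ℝ) := fun m hm =>
      norm_sin_pow_coeff (Nat.lt_succ_iff.1 (Finset.mem_range.1 hm))
    refine ⟨z, hz1.trans ?_, fun x _ => ?_⟩
    · rw [Finset.sum_congr rfl hnorm]
      simpa using (sum_choose_mul_exp l 0).le
    · rw [hz2, sin_pow_eq_sum, ← Finset.sum_filter_add_sum_filter_not (Finset.range (l + 1))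
        (fun m : ℕ => (2 * (m : ℤ) - l) ∈ Finset.Icc (-(d : ℤ)) d), sub_add_cancel_left, norm_neg]
      refine (norm_sum_le _ _).trans ?_
      calc _ = ∑ m ∈ (Finset.range (l + 1)).filter (fun m : ℕ => ¬ (2 * (m : ℤ) - l) ∈ Finset.Icc (-(d : ℤ)) d),
            (1 / 2 : ℝ) ^ l * (l.choose m : ℝ) := by
            refine Finset.sum_congr rfl fun m hm => ?_
            rw [norm_mul, hnorm m (Finset.mem_filter.1 hm).1,
              show Complex.I * ((2 * (m : ℤ) - l : ℤ) : ℂ) * (Real.pi : ℂ) * (x : ℂ) / 2 =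
                (((2 * (m : ℤ) - l : ℤ) * Real.pi * x / 2 : ℝ) : ℂ) * Complex.I by push_cast; ring,
              Complex.norm_exp_ofReal_mul_I, mul_one]
        _ ≤ 2 * Real.exp (l * (2 * (1 - γ)) ^ 2 / 2 - 2 * (1 - γ) * d) :=
            sum_choose_tail_le l d (by positivity)
        _ ≤ _ := by
            gcongr
            have hd : (0 : ℝ) ≤ d := Nat.cast_nonneg d
            nlinarith [mul_le_mul_of_nonneg_right hl hu.le, mul_nonneg hd hu.le]
  · refine ⟨0, by simp [coeffNorm], fun x hx => ?_⟩
    have hyr : |Real.sin (Real.pi * x / 2)| ≤ Real.cos (Real.pi * (1 - γ) / 2) := by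
      rw [← Real.sin_pi_div_two_sub,
        show Real.pi / 2 - Real.pi * (1 - γ) / 2 = Real.pi * γ / 2 by ring, abs_le, ← Real.sin_neg]
      constructor <;> apply Real.sin_le_sin_of_le_of_le_pi_div_two <;>
        nlinarith [hx.1, hx.2, hγ.1, hγ.2]
    have h0 : trigPoly d 0 x = 0 := by simp [trigPoly]
    rw [h0, zero_sub, norm_neg, norm_pow, Complex.norm_real, Real.norm_eq_abs]
    calc |Real.sin (Real.pi * x / 2)| ^ l ≤ Real.exp (-(1 - γ) ^ 2) ^ l :=
          pow_le_pow_left₀ (abs_nonneg _)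
            (hyr.trans (cos_pi_mul_div_two_le_exp hu.le (by linarith [hγ.1]))) l
      _ = Real.exp (l * -(1 - γ) ^ 2) := (Real.exp_nat_mul _ _).symm
      _ ≤ Real.exp (-((d : ℝ) / 2 * (1 - γ))) := by
          gcongr
          nlinarith [mul_le_mul_of_nonneg_right (not_le.1 hl).le hu.le]
      _ ≤ _ := by linarith [Real.exp_pos (-((d : ℝ) / 2 * (1 - γ)))]

/-! ### Transfer to operators by functional calculus -/

section Operators

variable {E : Type*} [NormedAddCommGroup E] [InnerProductSpace ℂ E] [CompleteSpace E]

theorem coe_timeEvolution (H : selfAdjoint (E →L[ℂ] E)) (t : ℝ) :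
    (timeEvolution H t : E →L[ℂ] E) =
      NormedSpace.exp ((Complex.I * (t : ℂ)) • (H : E →L[ℂ] E)) := by
  rw [timeEvolution, selfAdjoint.expUnitary_coe, selfAdjoint.val_smul, ← Complex.coe_smul,
    smul_smul]

theorem timeEvolution_add (H : selfAdjoint (E →L[ℂ] E)) (s t : ℝ) :
    timeEvolution H (s + t) = timeEvolution H s * timeEvolution H t := by
  let +nondep : NormedAlgebra ℚ (E →L[ℂ] E) := .restrictScalars ℚ ℂ (E →L[ℂ] E)
  refine Subtype.ext ?_
  rw [Submonoid.coe_mul, coe_timeEvolution, coe_timeEvolution, coe_timeEvolution,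
    ← NormedSpace.exp_add_of_commute, ← add_smul, Complex.ofReal_add, mul_add]
  exact ((Commute.refl (H : E →L[ℂ] E)).smul_left _).smul_right _

theorem timeEvolution_zpow (H : selfAdjoint (E →L[ℂ] E)) (t : ℝ) (j : ℤ) :
    timeEvolution H t ^ j = timeEvolution H (j * t) := by
  let f : Multiplicative ℝ →* unitary (E →L[ℂ] E) :=
    MonoidHom.mk' (fun s => timeEvolution H s.toAdd) fun s t => timeEvolution_add H s.toAdd t.toAdd
  have h := map_zpow f (Multiplicative.ofAdd t) j
  rw [← ofAdd_zsmul, zsmul_eq_mul] at h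
  exact h.symm

/-- Puts the powers of U and the Gibbs operator into one functional calculus of H, so that their
difference is governed by a scalar function on the spectrum. -/
theorem exp_smul_eq_cfc (H : selfAdjoint (E →L[ℂ] E)) (c : ℂ) :
    NormedSpace.exp (c • (H : E →L[ℂ] E)) =
      cfc (fun w : ℂ => Complex.exp (c * w)) (H : E →L[ℂ] E) := by
  have hH : IsStarNormal (H : E →L[ℂ] E) := H.2.isStarNormal
  have hcH : IsStarNormal (c • (H : E →L[ℂ] E)) := inferInstance
  rw [← CFC.complex_exp_eq_normedSpace_exp hcH]
  exact (cfc_comp_smul c Complex.exp (H : E →L[ℂ] E) (by fun_prop) hH).symm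

theorem norm_gibbsLaurent_sub_gibbsOperator_le {γ : ℝ} (hγ : 0 < γ) {H : selfAdjoint (E →L[ℂ] E)}
    {β : ℝ} (hH : H ≠ 0) {d : ℕ} {z : ℤ → ℂ} {δ : ℝ}
    (h : ∀ x ∈ Set.Icc (-γ) γ, ‖trigPoly d z x -
      (Real.exp (-(β * ‖(H : E →L[ℂ] E)‖ / γ) * (x + 1)) : ℂ)‖ ≤ δ) :
    ‖gibbsLaurent β γ H d z - gibbsOperator β H‖ ≤
      δ * Real.exp (β * ‖(H : E →L[ℂ] E)‖ / γ) := by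
  set T : E →L[ℂ] E := (H : E →L[ℂ] E) with hT
  have hT0 : 0 < ‖T‖ := norm_pos_iff.2 fun h0 => hH (Subtype.ext h0)
  -- The sign of δ is not assumed; the hypothesis at x = 0 forces it.
  have hδ : 0 ≤ δ := (norm_nonneg _).trans (h 0 ⟨by linarith, hγ.le⟩)
  set lam := β * ‖T‖ / γ with hlam
  have hU : ∀ j : ℤ, ((timeEvolution H (gibbsTimeStep γ H) ^ j : unitary (E →L[ℂ] E)) : E →L[ℂ] E) =
      cfc (fun w : ℂ => Complex.exp ((Complex.I * (j : ℂ) * (gibbsTimeStep γ H : ℝ)) * w)) T := by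
    intro j
    rw [timeEvolution_zpow, ← exp_smul_eq_cfc, coe_timeEvolution]
    push_cast
    rw [mul_assoc]
  have hdiff : gibbsLaurent β γ H d z - gibbsOperator β H =
      cfc (fun w : ℂ => (∑ j ∈ Finset.Icc (-(d : ℤ)) (d : ℤ), ((Real.exp lam : ℂ) * z j) *
        Complex.exp ((Complex.I * (j : ℂ) * (gibbsTimeStep γ H : ℝ)) * w)) -
          Complex.exp (((-β : ℝ) : ℂ) * w)) T := by
    rw [cfc_sub (fun w : ℂ => ∑ j ∈ Finset.Icc (-(d : ℤ)) (d : ℤ), ((Real.exp lam : ℂ) * z j) *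
        Complex.exp ((Complex.I * (j : ℂ) * (gibbsTimeStep γ H : ℝ)) * w))
        (fun w : ℂ => Complex.exp (((-β : ℝ) : ℂ) * w)) T (by fun_prop) (by fun_prop),
      ← exp_smul_eq_cfc, gibbsOperator, gibbsLaurent, laurentInUnitary]
    congr 1
    rw [← Finset.sum_fn, cfc_sum _ _ _ (fun j _ => by fun_prop)]
    refine Finset.sum_congr rfl fun j _ => ?_
    rw [hU, cfc_const_mul _ _ _ (by fun_prop)]
  rw [hdiff]
  refine norm_cfc_le (by positivity) fun w hw => ?_
  have hre := IsSelfAdjoint.mem_spectrum_eq_re H.2 hw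
  set r := w.re with hr
  have hrT : |r| ≤ ‖T‖ := (Complex.abs_re_le_norm w).trans
    ((spectrum.norm_le_norm_mul_of_mem hw).trans
      (mul_le_of_le_one_right hT0.le ContinuousLinearMap.norm_id_le))
  -- For x = γr/‖H‖, the phase r·dt equals πx/2, and e^λ e^{-λ(x+1)} = e^{-λx} = e^{-βr}.
  have hx : γ * r / ‖T‖ ∈ Set.Icc (-γ) γ := by
    have h1 := abs_le.1 hrT
    rw [Set.mem_Icc, le_div_iff₀ hT0, div_le_iff₀ hT0]
    constructor <;> nlinarith
  have hkey : (∑ j ∈ Finset.Icc (-(d : ℤ)) (d : ℤ), ((Real.exp lam : ℂ) * z j) *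
        Complex.exp ((Complex.I * (j : ℂ) * (gibbsTimeStep γ H : ℝ)) * w)) -
          Complex.exp (((-β : ℝ) : ℂ) * w) =
      (Real.exp lam : ℂ) * (trigPoly d z (γ * r / ‖T‖) -
        (Real.exp (-lam * (γ * r / ‖T‖ + 1)) : ℂ)) := by
    rw [mul_sub, trigPoly, Finset.mul_sum]
    congr 1
    · refine Finset.sum_congr rfl fun j _ => ?_
      rw [mul_assoc, gibbsTimeStep, hre]
      congr 3
      push_cast
      ring
    · rw [hre, ← Complex.ofReal_mul, ← Complex.ofReal_exp, ← Complex.ofReal_mul, ← Real.exp_add]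
      congr 2
      rw [hlam]
      field_simp
      ring
  rw [hkey, norm_mul, Complex.norm_real, Real.norm_of_nonneg (Real.exp_pos _).le, mul_comm δ]
  exact mul_le_mul_of_nonneg_left (h _ hx) (Real.exp_pos _).le

end Operators

/-! ### Assembly and choice of degree -/

/-- Approximation of `e^{-λ(x+1)}` by trigonometric polynomials of degree `d`, uniformly in `λ`. -/
theorem exists_trigPoly_approx_exp {γ : ℝ} (hγ : γ ∈ Set.Ioo (0 : ℝ) 1) {lam : ℝ} (hlam : 0 < lam)
    (d : ℕ) : ∃ z : ℤ → ℂ, coeffNorm d z ≤ 1 ∧ ∀ x ∈ Set.Icc (-γ) γ,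
      ‖trigPoly d z x - (Real.exp (-lam * (x + 1)) : ℂ)‖ ≤
        4 * Real.exp (-((d : ℝ) / 2 * (1 - γ))) := by
  set η := Real.exp (-((d : ℝ) / 2 * (1 - γ))) with hη
  have hη0 : 0 < η := Real.exp_pos _
  -- Replacing the powers of the sine costs 2η in total, because the coefficients of p have absolute
  -- sum at most 1; the other 2η goes to p itself.
  obtain ⟨p, hp1, hp⟩ := exists_polynomial_approx_exp hγ hlam (ε := 2 * η) (by positivity)
  choose Z hZ1 hZ using exists_trigPoly_approx_sin_pow hγ d
  set R := Finset.range (p.natDegree + 1) with hR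
  have hlin : ∀ x, trigPoly d (fun j => ∑ n ∈ R, (p.coeff n : ℂ) * Z n j) x =
      ∑ n ∈ R, (p.coeff n : ℂ) * trigPoly d (Z n) x := fun x => by
    simp only [trigPoly, Finset.sum_mul, Finset.mul_sum]
    rw [Finset.sum_comm]
    simp only [mul_assoc]
  refine ⟨fun j => ∑ n ∈ R, (p.coeff n : ℂ) * Z n j, ?_, fun x hx => ?_⟩
  · calc coeffNorm d _ ≤ ∑ j ∈ Finset.Icc (-(d : ℤ)) d, ∑ n ∈ R, |p.coeff n| * ‖Z n j‖ := by
          refine Finset.sum_le_sum fun j _ => (norm_sum_le _ _).trans (le_of_eq ?_)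
          simp only [norm_mul, Complex.norm_real, Real.norm_eq_abs]
      _ = ∑ n ∈ R, |p.coeff n| * coeffNorm d (Z n) := by
          rw [Finset.sum_comm]
          simp only [coeffNorm, Finset.mul_sum]
      _ ≤ ∑ n ∈ R, |p.coeff n| :=
          Finset.sum_le_sum fun n _ => mul_le_of_le_one_right (abs_nonneg _) (hZ1 n)
      _ ≤ 1 := hp1
  · set y := Real.sin (Real.pi * x / 2) with hy
    have h1 : ‖trigPoly d (fun j => ∑ n ∈ R, (p.coeff n : ℂ) * Z n j) x - ((p.eval y : ℝ) : ℂ)‖ ≤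
        2 * η := by
      rw [hlin, Polynomial.eval_eq_sum_range, Complex.ofReal_sum, ← Finset.sum_sub_distrib]
      calc _ ≤ ∑ n ∈ R, |p.coeff n| * (2 * η) := by
            refine norm_sum_le_of_le _ fun n _ => ?_
            rw [Complex.ofReal_mul, Complex.ofReal_pow, ← mul_sub, norm_mul, Complex.norm_real,
              Real.norm_eq_abs]
            exact mul_le_mul_of_nonneg_left (hZ n x hx) (abs_nonneg _)
        _ = (∑ n ∈ R, |p.coeff n|) * (2 * η) := (Finset.sum_mul ..).symm
        _ ≤ 2 * η := mul_le_of_le_one_left (by positivity) hp1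
    have h2 : ‖((p.eval y : ℝ) : ℂ) - (Real.exp (-lam * (x + 1)) : ℂ)‖ ≤ 2 * η := by
      rw [← Complex.ofReal_sub, Complex.norm_real]
      exact hp x hx
    calc _ ≤ _ := norm_sub_le_norm_sub_add_norm_sub _ ((p.eval y : ℝ) : ℂ) _
      _ ≤ 4 * η := by linarith

theorem four_mul_exp_gibbsDegree_le {γ δ : ℝ} (hγ : γ ∈ Set.Ioo (0 : ℝ) 1)
    (hδ : δ ∈ Set.Ioo (0 : ℝ) 1) :
    4 * Real.exp (-((gibbsDegree γ δ : ℝ) / 2 * (1 - γ))) ≤ δ := by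
  have hu : 0 < 1 - γ := sub_pos.2 hγ.2
  have hδ0 := hδ.1
  have h1 : Real.log (4 / δ) ≤ (gibbsDegree γ δ : ℝ) / 2 * (1 - γ) := by
    rw [← div_le_iff₀ hu, gibbsDegree, Nat.cast_mul, Nat.cast_ofNat, mul_div_cancel_left₀ _ two_ne_zero]
    exact Nat.le_ceil _
  calc _ ≤ 4 * Real.exp (-Real.log (4 / δ)) := by gcongr
    _ = δ := by
      rw [Real.exp_neg, Real.exp_log (by positivity)]
      field_simp

theorem mainTheorem4 {E : Type*} [NormedAddCommGroup E] [InnerProductSpace ℂ E] [CompleteSpace E]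
    (γ : ℝ) (hγ : γ ∈ Set.Ioo (0 : ℝ) 1) :
    -- the trigonometric approximation of the exponential
    (∀ δ ∈ Set.Ioo (0 : ℝ) 1, ∀ lam : ℝ, 0 < lam →
      ∃ z : ℤ → ℂ,
        coeffNorm (gibbsDegree γ δ) z ≤ 1 ∧
        ∀ x ∈ Set.Icc (-γ) γ,
          ‖trigPoly (gibbsDegree γ δ) z x - (Real.exp (-lam * (x + 1)) : ℂ)‖ ≤ δ) ∧
    -- every such approximation yields an approximation of the Gibbs operator
    (∀ (H : selfAdjoint (E →L[ℂ] E)) (β : ℝ), H ≠ 0 → 0 < β →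
      ∀ (d : ℕ) (z : ℤ → ℂ) (δ : ℝ),
        (∀ x ∈ Set.Icc (-γ) γ,
          ‖trigPoly d z x -
            (Real.exp (-(β * ‖(H : E →L[ℂ] E)‖ / γ) * (x + 1)) : ℂ)‖ ≤ δ) →
        ‖gibbsLaurent β γ H d z - gibbsOperator β H‖ ≤
          δ * Real.exp (β * ‖(H : E →L[ℂ] E)‖ / γ)) ∧
    -- the resulting error bound as a function of the degree
    (∀ (H : selfAdjoint (E →L[ℂ] E)) (β : ℝ), H ≠ 0 → 0 < β →
      ∀ d : ℕ, ∃ z : ℤ → ℂ,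
        coeffNorm d z ≤ 1 ∧
        (∀ x ∈ Set.Icc (-γ) γ,
          ‖trigPoly d z x -
            (Real.exp (-(β * ‖(H : E →L[ℂ] E)‖ / γ) * (x + 1)) : ℂ)‖ ≤
              4 * Real.exp (-((d : ℝ) / 2 * (1 - γ)))) ∧
        ‖gibbsLaurent β γ H d z - gibbsOperator β H‖ ≤
          4 * Real.exp (β * ‖(H : E →L[ℂ] E)‖ / γ - (d : ℝ) / 2 * (1 - γ))) := by
  refine ⟨fun δ hδ lam hlam => ?_, fun H β hH _ d z δ h =>
    norm_gibbsLaurent_sub_gibbsOperator_le hγ.1 hH h, fun H β hH hβ d => ?_⟩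
  · obtain ⟨z, hz1, hz⟩ := exists_trigPoly_approx_exp hγ hlam (gibbsDegree γ δ)
    exact ⟨z, hz1, fun x hx => (hz x hx).trans (four_mul_exp_gibbsDegree_le hγ hδ)⟩
  · have hT0 : 0 < ‖(H : E →L[ℂ] E)‖ := norm_pos_iff.2 fun h0 => hH (Subtype.ext h0)
    obtain ⟨z, hz1, hz⟩ := exists_trigPoly_approx_exp hγ (div_pos (mul_pos hβ hT0) hγ.1) d
    refine ⟨z, hz1, hz, (norm_gibbsLaurent_sub_gibbsOperator_le hγ.1 hH hz).trans (le_of_eq ?_)⟩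
    rw [mul_assoc, ← Real.exp_add]
    ring_nf
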